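/- Let $H$ be a finite-dimensional complex Hilbert space with a fixed orthonormal basis, with matrix units $(e_{ij})$ and transpose map $t$ on $B(H)$ with respect to that basis. Let $P(H)$ and $CP(H)$ denote the positive, respectively completely positive, linear maps of $B(H)$ into itself. For a linear map $\phi$ of $B(H)$ into itself let $\phi^*$ be the linear map determined by $\mathrm{Tr}(\phi(a)b)=\mathrm{Tr}(a\,\phi^*(b))$ for all $a,b\in B(H)$, let $\phi^t=t\circ\phi\circ t$, and let $C_\phi=\sum_{i,j}e_{ij}\otimes\phi(e_{ij})\in B(H\otimes H)$. A mapping cone is a closed convex cone $\mathcal K\subset P(H)$ (containing $0$) such that $\alpha\circ\phi\in\mathcal K$ and $\phi\circ\alpha\in\mathcal K$ for all $\phi\in\mathcal K$ and $\alpha\in CP(H)$; it is symmetric if, for every linear map $\phi$ of $B(H)$ into itself, $\phi\in\mathcal K$ iff $\phi^*\in\mathcal K$ iff $\phi^t\in\mathcal K$. For a mapping cone $\mathcal K$ put $$\mathcal K^\circ=\{\phi\in P(H):\mathrm{Tr}(C_\phi C_\alpha)\ge 0\ \text{ for all }\alpha\in\mathcal K\},$$ let $C^{\mathcal K}\subset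 B(H\otimes H)$ be the closed convex cone generated by the cones $(\iota\otimes\alpha^*)(B(H\otimes H)^+)$, $\alpha\in\mathcal K$, where $\iota$ is the identity map of $B(H)$, and put $$\mathcal K^\sharp=\{\beta\in P(H):(\iota\otimes\beta)(x)\ge 0\ \text{ for all }x\in C^{\mathcal K}\}.$$ Let $\mathcal K$ be a symmetric mapping cone. Then $\mathcal K^\sharp=\mathcal K^\circ$. Moreover $$\mathcal K^\sharp=\{\beta\in P(H):\beta\circ\alpha^*\in CP(H)\ \text{ for all }\alpha\in\mathcal K\},$$ and $\mathcal K^\sharp$ is again a symmetric mapping cone. -/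

import Mathlib

open scoped TensorProduct ComplexOrder InnerProductSpace

noncomputable section

namespace MappingCones

/-- `B(H)`, the bounded operators on `H`. Its order is Mathlib's Loewner order: `0 ≤ a` means that
`a` is a positive operator. -/
abbrev Op (H : Type*) [NormedAddCommGroup H] [InnerProductSpace ℂ H] : Type _ := H →L[ℂ] H

/-- The (bounded) linear maps of `B(H)` into itself, with the operator norm. For finite dimensional
`H` these are all the linear maps of `B(H)` into itself. -/
abbrev OpMap (H : Type*) [NormedAddCommGroup H] [InnerProductSpace ℂ H] : Type _ :=
  Op H →L[ℂ] Op H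

section Defs

variable {H : Type*} [NormedAddCommGroup H] [InnerProductSpace ℂ H]

/-- The trace of an operator. -/
def tr (a : Op H) : ℂ := LinearMap.trace ℂ H (a : H →ₗ[ℂ] H)

/-- `φ ∈ P(H)`: the map `φ` is positive. -/
def IsPositiveMap (φ : OpMap H) : Prop := ∀ a : Op H, 0 ≤ a → 0 ≤ φ a

/-- `φ ∈ CP(H)`: the map `φ` is completely positive. -/
def IsCP [CompleteSpace H] (φ : OpMap H) : Prop :=
  ∃ Φ : CompletelyPositiveMap (Op H) (Op H), ∀ a : Op H, Φ a = φ a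

/-- A mapping cone: a closed convex subcone of `P(H)` that is closed under composition, on either
side, with completely positive maps. -/
structure IsMappingCone [CompleteSpace H] (K : Set (OpMap H)) : Prop where
  isPositiveMap : ∀ φ ∈ K, IsPositiveMap φ
  zero_mem : 0 ∈ K
  add_mem : ∀ φ ∈ K, ∀ ψ ∈ K, φ + ψ ∈ K
  smul_mem : ∀ c : ℝ, 0 ≤ c → ∀ φ ∈ K, c • φ ∈ K
  isClosed : IsClosed K
  comp_left : ∀ α : OpMap H, IsCP α → ∀ φ ∈ K, α.comp φ ∈ K
  comp_right : ∀ α : OpMap H, IsCP α → ∀ φ ∈ K, φ.comp α ∈ K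

/-- The matrix units `e i j` belonging to an orthonormal basis, `e i j x = ⟪b j, x⟫ • b i`. -/
def matrixUnit {ι : Type*} [Fintype ι] (b : OrthonormalBasis ι ℂ H) (i j : ι) : Op H :=
  InnerProductSpace.rankOne ℂ (b i) (b j)

theorem eq_sum_matrixUnit {ι : Type*} [Fintype ι] (b : OrthonormalBasis ι ℂ H) (a : Op H) :
    a = ∑ i, ∑ j, ⟪b i, a (b j)⟫_ℂ • matrixUnit b i j := by
  classical
  have h : (a : H →ₗ[ℂ] H)
      = ((∑ i, ∑ j, ⟪b i, a (b j)⟫_ℂ • matrixUnit b i j : Op H) : H →ₗ[ℂ] H) := by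
    refine b.toBasis.ext fun k => ?_
    simp only [OrthonormalBasis.coe_toBasis, ContinuousLinearMap.coe_coe, matrixUnit,
      sum_apply, smul_apply,
      InnerProductSpace.rankOne_apply, OrthonormalBasis.inner_eq_ite]
    simpa using (b.sum_repr' (a (b k))).symm
  exact ContinuousLinearMap.coe_injective h

theorem tr_mul_matrixUnit {ι : Type*} [Fintype ι] (b : OrthonormalBasis ι ℂ H) (a : Op H)
    (i j : ι) : tr (a * matrixUnit b i j) = ⟪b j, a (b i)⟫_ℂ := by
  classical
  rw [tr, LinearMap.trace_eq_sum_inner _ b, Finset.sum_eq_single j]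
  · simp [matrixUnit]
  · intro k _ hk
    simp [matrixUnit, Ne.symm hk]
  · simp

variable [FiniteDimensional ℂ H]

/-- The transpose map `t` on `B(H)` with respect to the orthonormal basis `b`. -/
def transposeMap {ι : Type*} [Fintype ι] (b : OrthonormalBasis ι ℂ H) : OpMap H :=
  LinearMap.toContinuousLinearMap
    { toFun := fun a => ∑ i, ∑ j, ⟪b j, a (b i)⟫_ℂ • matrixUnit b i j
      map_add' := fun a a' => by
        simp only [add_apply, inner_add_right, add_smul,
          Finset.sum_add_distrib]
      map_smul' := fun c a => by
        simp only [smul_apply, inner_smul_right, mul_smul, Finset.smul_sum,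
          RingHom.id_apply] }

theorem inner_transposeMap {ι : Type*} [Fintype ι] (b : OrthonormalBasis ι ℂ H) (a : Op H)
    (i j : ι) : ⟪b i, transposeMap b a (b j)⟫_ℂ = ⟪b j, a (b i)⟫_ℂ := by
  classical
  simp [transposeMap, matrixUnit, OrthonormalBasis.inner_eq_ite]

/-- `φ^t = t ∘ φ ∘ t`. -/
def transposeConj {ι : Type*} [Fintype ι] (b : OrthonormalBasis ι ℂ H) (φ : OpMap H) : OpMap H :=
  ((transposeMap b).comp φ).comp (transposeMap b)

/-- The adjoint map `φ^*` in the Hilbert-Schmidt structure; it is the unique map with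
`Tr (φ(a) x) = Tr (a φ^*(x))`, see `tr_hsAdjoint` and `eq_hsAdjoint`. -/
def hsAdjoint (φ : OpMap H) : OpMap H :=
  LinearMap.toContinuousLinearMap
    { toFun := fun x => ∑ i, ∑ j,
        tr (φ (matrixUnit (stdOrthonormalBasis ℂ H) j i) * x) •
          matrixUnit (stdOrthonormalBasis ℂ H) i j
      map_add' := fun x y => by
        simp [tr, mul_add, add_smul, Finset.sum_add_distrib]
      map_smul' := fun c x => by
        simp [tr, mul_smul, Finset.smul_sum] }

theorem tr_hsAdjoint (φ : OpMap H) (a x : Op H) : tr (φ a * x) = tr (a * hsAdjoint φ x) := by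
  set b := stdOrthonormalBasis ℂ H with hb
  have tr_sum : ∀ f : Fin (Module.finrank ℂ H) → Op H, tr (∑ i, f i) = ∑ i, tr (f i) := by
    intro f; simp [tr]
  have tr_smul : ∀ (c : ℂ) (y : Op H), tr (c • y) = c * tr y := by
    intro c y; simp [tr]
  have h1 : tr (φ a * x)
      = ∑ i, ∑ j, ⟪b i, a (b j)⟫_ℂ * tr (φ (matrixUnit b i j) * x) := by
    conv_lhs => rw [eq_sum_matrixUnit b a]
    simp only [map_sum, map_smul, Finset.sum_mul, smul_mul_assoc, tr_sum, tr_smul]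
  have h2 : tr (a * hsAdjoint φ x)
      = ∑ i, ∑ j, tr (φ (matrixUnit b j i) * x) * ⟪b j, a (b i)⟫_ℂ := by
    simp only [hsAdjoint, LinearMap.coe_toContinuousLinearMap', LinearMap.coe_mk, AddHom.coe_mk,
      Finset.mul_sum, mul_smul_comm, tr_sum, tr_smul, ← hb, tr_mul_matrixUnit]
  rw [h1, h2, Finset.sum_comm]
  simp only [mul_comm]

theorem eq_hsAdjoint (φ ψ : OpMap H) (h : ∀ a x : Op H, tr (φ a * x) = tr (a * ψ x)) :
    ψ = hsAdjoint φ := by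
  refine ContinuousLinearMap.ext fun x => ?_
  have key : ∀ i j, ⟪stdOrthonormalBasis ℂ H j, ψ x (stdOrthonormalBasis ℂ H i)⟫_ℂ
      = ⟪stdOrthonormalBasis ℂ H j, hsAdjoint φ x (stdOrthonormalBasis ℂ H i)⟫_ℂ := by
    intro i j
    have hc : ∀ a y : Op H, tr (a * y) = tr (y * a) := fun a y => by
      simpa [tr] using LinearMap.trace_mul_comm ℂ (a : H →ₗ[ℂ] H) (y : H →ₗ[ℂ] H)
    rw [← tr_mul_matrixUnit, ← tr_mul_matrixUnit, hc, ← h, tr_hsAdjoint, hc]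
  rw [eq_sum_matrixUnit (stdOrthonormalBasis ℂ H) (ψ x),
    eq_sum_matrixUnit (stdOrthonormalBasis ℂ H) (hsAdjoint φ x)]
  simp only [key]

/-- A symmetric mapping cone: `φ ∈ K` iff `φ^* ∈ K` iff `φ^t ∈ K`. -/
structure IsSymmetricMappingCone [CompleteSpace H] {ι : Type*} [Fintype ι]
    (b : OrthonormalBasis ι ℂ H) (K : Set (OpMap H)) : Prop extends IsMappingCone K where
  hsAdjoint_mem_iff : ∀ φ : OpMap H, φ ∈ K ↔ hsAdjoint φ ∈ K
  transposeConj_mem_iff : ∀ φ : OpMap H, φ ∈ K ↔ transposeConj b φ ∈ K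

/-- The operator `a ⊗ a'` on the Hilbert space `H ⊗ H`. -/
def tensorOp (a a' : Op H) : Op (H ⊗[ℂ] H) :=
  LinearMap.toContinuousLinearMap (TensorProduct.map (a : H →ₗ[ℂ] H) (a' : H →ₗ[ℂ] H))

/-- The Choi matrix `C_φ = ∑ e_{ij} ⊗ φ(e_{ij})`, an operator on `H ⊗ H`. -/
def choi {ι : Type*} [Fintype ι] (b : OrthonormalBasis ι ℂ H) (φ : OpMap H) : Op (H ⊗[ℂ] H) :=
  ∑ i, ∑ j, tensorOp (matrixUnit b i j) (φ (matrixUnit b i j))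

/-- The dual cone `K° = {φ ∈ P(H) : Tr (C_φ C_α) ≥ 0 for all α ∈ K}`. The order on `ℂ` is the
usual one: `0 ≤ z` means that `z` is real and nonnegative. -/
def dualCone {ι : Type*} [Fintype ι] (b : OrthonormalBasis ι ℂ H) (K : Set (OpMap H)) :
    Set (OpMap H) :=
  {φ | IsPositiveMap φ ∧ ∀ α ∈ K, 0 ≤ tr (choi b φ * choi b α)}

/-- The map `ι ⊗ φ` of `B(H ⊗ H) = B(H) ⊗ B(H)` into itself, where `ι` is the identity map of
`B(H)`; see `idTensor_tensorOp`. -/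
def idTensor (φ : OpMap H) : OpMap (H ⊗[ℂ] H) :=
  LinearMap.toContinuousLinearMap <|
    LinearMap.toContinuousLinearMap.toLinearMap ∘ₗ
      (homTensorHomEquiv ℂ H H H H).toLinearMap ∘ₗ
        LinearMap.lTensor (H →ₗ[ℂ] H)
          (LinearMap.toContinuousLinearMap.symm.toLinearMap ∘ₗ (φ : Op H →ₗ[ℂ] Op H) ∘ₗ
            LinearMap.toContinuousLinearMap.toLinearMap) ∘ₗ
          (homTensorHomEquiv ℂ H H H H).symm.toLinearMap ∘ₗ
            LinearMap.toContinuousLinearMap.symm.toLinearMap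

theorem idTensor_tensorOp (φ : OpMap H) (a a' : Op H) :
    idTensor φ (tensorOp a a') = tensorOp a (φ a') := by
  have h : (homTensorHomEquiv ℂ H H H H).symm
      (TensorProduct.map (a : H →ₗ[ℂ] H) (a' : H →ₗ[ℂ] H))
        = (a : H →ₗ[ℂ] H) ⊗ₜ[ℂ] (a' : H →ₗ[ℂ] H) := by
    rw [LinearEquiv.symm_apply_eq]
    simp [homTensorHomEquiv_apply]
  have h' : LinearMap.toContinuousLinearMap (a' : H →ₗ[ℂ] H) = a' := by ext; rfl
  simp [idTensor, tensorOp, h, h']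

/-- The cone `C^K`: the closed convex cone generated by all the cones `(ι ⊗ α^*)(B(H ⊗ H)^+)`,
`α ∈ K`. -/
def coneC (K : Set (OpMap H)) : Set (Op (H ⊗[ℂ] H)) :=
  closure (PointedCone.hull ℝ
    {x | ∃ α ∈ K, ∃ y : Op (H ⊗[ℂ] H), 0 ≤ y ∧ x = idTensor (hsAdjoint α) y} :
      PointedCone ℝ (Op (H ⊗[ℂ] H)))

/-- The cone `K♯ = {β ∈ P(H) : (ι ⊗ β)(x) ≥ 0 for all x ∈ C^K}`. -/
def sharp (K : Set (OpMap H)) : Set (OpMap H) :=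
  {β | IsPositiveMap β ∧ ∀ x ∈ coneC K, 0 ≤ idTensor β x}

end Defs

end MappingCones

end

/-!
Let `T φ` denote the trace of `φ` as an endomorphism of the vector space `B(H)` (`superTrace`). It
is cyclic, and invariant under `φ ↦ φ^*`. The pairing of Choi matrices is
`Tr (C_β C_α) = T (β^* ∘ α) = T (β ∘ α^*)`.

For finite dimensional `H`, complete positivity of `φ` is equivalent to positivity of the Choi
matrix, to the existence of a Kraus decomposition `φ = ∑ Ad_{v_k}`, and to positivity of `ι ⊗ φ` on
`B(H ⊗ H)`. The last form identifies `K♯` with the set of the positive `β` such that `β ∘ α^*` is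
completely positive for all `α ∈ K` (`mem_sharp_iff`).

Every vector of `H ⊗ H` has the form `∑ b i ⊗ v† (b i)`, and the quadratic form of `C_φ` at this
vector is `T (Ad_v ∘ φ)`. For `φ = β ∘ α^*`, cyclicity moves `Ad_v` next to `α^*`, where it is
absorbed by the mapping cone: `α^* ∘ Ad_v = (Ad_{v†} ∘ α)^*`. So complete positivity of all the
`β ∘ α^*` only says that `T (β ∘ α^*) ≥ 0` for all `α ∈ K` (`mem_sharp_iff_superTrace`), which is
the definition of `K°`.

The symmetry and closure of `K♯` follow from its two descriptions: invariance under adjoints and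
transposes, the convex cone operations and closedness from the scalar one; invariance under
composition with completely positive maps from the other, as these maps are stable under adjoints
and composition. -/

open scoped TensorProduct ComplexOrder InnerProductSpace

noncomputable section

namespace MappingCones

/-! ### Operators, matrix units and the trace of a linear map of `B(H)` -/

section Elementary

variable {H : Type*} [NormedAddCommGroup H] [InnerProductSpace ℂ H]

theorem tr_mul_comm (a b : Op H) : tr (a * b) = tr (b * a) :=
  LinearMap.trace_mul_comm ℂ (a : H →ₗ[ℂ] H) (b : H →ₗ[ℂ] H)

theorem tr_sum {κ : Type*} (s : Finset κ) (f : κ → Op H) :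
    tr (∑ k ∈ s, f k) = ∑ k ∈ s, tr (f k) := by
  simp [tr]

theorem tr_smul (c : ℂ) (a : Op H) : tr (c • a) = c * tr a := by
  simp [tr]

theorem nonneg_iff_forall_inner (a : Op H) : 0 ≤ a ↔ ∀ x, 0 ≤ ⟪x, a x⟫_ℂ := by
  rw [ContinuousLinearMap.nonneg_iff_isPositive]
  refine ⟨fun h x => h.inner_nonneg_right x, fun h => ?_⟩
  rw [ContinuousLinearMap.isPositive_iff_complex]
  intro x
  have hx := h x
  rw [← inner_conj_symm, RCLike.nonneg_iff] at hx
  simp only [RCLike.conj_re, RCLike.conj_im, neg_eq_zero] at hx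
  exact ⟨RCLike.ext (by simp) (by simpa using hx.2.symm), hx.1⟩

theorem IsPositiveMap.comp {φ ψ : OpMap H} (hφ : IsPositiveMap φ) (hψ : IsPositiveMap ψ) :
    IsPositiveMap (φ.comp ψ) := fun a ha => hφ _ (hψ a ha)

theorem real_smul_nonneg {c : ℝ} (hc : 0 ≤ c) {a : Op H} (ha : 0 ≤ a) : 0 ≤ c • a := by
  rw [nonneg_iff_forall_inner] at ha ⊢
  intro x
  rw [smul_apply, inner_smul_right_eq_smul]
  exact smul_nonneg hc (ha x)

variable {ι : Type*} [Fintype ι] (b : OrthonormalBasis ι ℂ H)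

theorem matrixUnit_apply (i j : ι) (x : H) : matrixUnit b i j x = ⟪b j, x⟫_ℂ • b i := by
  simp [matrixUnit]

theorem inner_matrixUnit [DecidableEq ι] (i j k l : ι) :
    ⟪b k, matrixUnit b i j (b l)⟫_ℂ = if k = i ∧ j = l then 1 else 0 := by
  simp only [matrixUnit_apply, inner_smul_right, OrthonormalBasis.inner_eq_ite]
  split_ifs <;> simp_all

theorem matrixUnit_mul [DecidableEq ι] (i j k l : ι) :
    matrixUnit b i j * matrixUnit b k l = if j = k then matrixUnit b i l else 0 := by
  ext x
  simp only [mul_apply_eq_comp, matrixUnit_apply, inner_smul_right,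
    OrthonormalBasis.inner_eq_ite]
  split_ifs <;> simp [matrixUnit_apply]

theorem op_ext {a a' : Op H} (h : ∀ i j, ⟪b i, a (b j)⟫_ℂ = ⟪b i, a' (b j)⟫_ℂ) : a = a' := by
  rw [eq_sum_matrixUnit b a, eq_sum_matrixUnit b a']
  simp only [h]

theorem opMap_ext {φ ψ : OpMap H}
    (h : ∀ i j, φ (matrixUnit b i j) = ψ (matrixUnit b i j)) : φ = ψ := by
  refine ContinuousLinearMap.ext fun a => ?_
  rw [eq_sum_matrixUnit b a]
  simp only [map_sum, map_smul, h]

/-- The trace of a linear map `φ` of `B(H)` into itself, as an endomorphism of the vector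
space `B(H)`, computed in the basis of matrix units. -/
def superTrace (φ : OpMap H) : ℂ := ∑ i, ∑ j, ⟪b i, φ (matrixUnit b i j) (b j)⟫_ℂ

theorem superTrace_comp (φ ψ : OpMap H) : superTrace b (φ.comp ψ)
    = ∑ i, ∑ j, ∑ k, ∑ l, ⟪b k, ψ (matrixUnit b i j) (b l)⟫_ℂ *
        ⟪b i, φ (matrixUnit b k l) (b j)⟫_ℂ := by
  refine Finset.sum_congr rfl fun i _ => Finset.sum_congr rfl fun j _ => ?_
  rw [ContinuousLinearMap.comp_apply]
  conv_lhs => rw [eq_sum_matrixUnit b (ψ (matrixUnit b i j))]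
  simp only [map_sum, map_smul, sum_apply, smul_apply,
    inner_sum, inner_smul_right]

theorem superTrace_comp_comm (φ ψ : OpMap H) :
    superTrace b (φ.comp ψ) = superTrace b (ψ.comp φ) := by
  have hswap : ∀ f : ι → ι → ι → ι → ℂ,
      ∑ i, ∑ j, ∑ k, ∑ l, f i j k l = ∑ k, ∑ l, ∑ i, ∑ j, f i j k l := by
    intro f
    have h := Finset.sum_comm (s := (Finset.univ : Finset (ι × ι)))
      (t := (Finset.univ : Finset (ι × ι))) (f := fun p q => f p.1 p.2 q.1 q.2)
    simpa only [Fintype.sum_prod_type] using h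
  rw [superTrace_comp, superTrace_comp, hswap]
  simp only [mul_comm]

theorem superTrace_eq_sum_tr (φ : OpMap H) :
    superTrace b φ = ∑ i, ∑ j, tr (φ (matrixUnit b i j) * matrixUnit b j i) := by
  simp only [superTrace, tr_mul_matrixUnit]

/-- Conjugation `a ↦ v a v†`. -/
def conjMap [CompleteSpace H] (v : Op H) : OpMap H :=
  (ContinuousLinearMap.mul ℂ (Op H) v).comp ((ContinuousLinearMap.mul ℂ (Op H)).flip (star v))

theorem conjMap_apply [CompleteSpace H] (v a : Op H) : conjMap v a = v * (a * star v) := rfl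

theorem inner_conjMap [CompleteSpace H] (v a : Op H) (x y : H) :
    ⟪x, conjMap v a y⟫_ℂ = ⟪star v x, a (star v y)⟫_ℂ := by
  rw [conjMap_apply, mul_apply_eq_comp, mul_apply_eq_comp,
    ContinuousLinearMap.star_eq_adjoint, ContinuousLinearMap.adjoint_inner_left]

end Elementary

/-! ### The Hilbert-Schmidt adjoint and the transpose -/

section HSAdjoint

variable {H : Type*} [NormedAddCommGroup H] [InnerProductSpace ℂ H] [FiniteDimensional ℂ H]

theorem hsAdjoint_hsAdjoint (φ : OpMap H) : hsAdjoint (hsAdjoint φ) = φ :=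
  (eq_hsAdjoint _ _ fun a x => by
    rw [tr_mul_comm, ← tr_hsAdjoint, tr_mul_comm]).symm

theorem hsAdjoint_comp (φ ψ : OpMap H) :
    hsAdjoint (φ.comp ψ) = (hsAdjoint ψ).comp (hsAdjoint φ) :=
  (eq_hsAdjoint _ _ fun a x => by
    rw [ContinuousLinearMap.comp_apply, ContinuousLinearMap.comp_apply, tr_hsAdjoint,
      tr_hsAdjoint]).symm

theorem hsAdjoint_sum {κ : Type*} [Fintype κ] (φ : κ → OpMap H) :
    hsAdjoint (∑ k, φ k) = ∑ k, hsAdjoint (φ k) :=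
  (eq_hsAdjoint _ _ fun a x => by
    simp only [sum_apply, Finset.sum_mul, Finset.mul_sum, tr_sum, tr_hsAdjoint]).symm

theorem hsAdjoint_conjMap [CompleteSpace H] (v : Op H) :
    hsAdjoint (conjMap v) = conjMap (star v) :=
  (eq_hsAdjoint _ _ fun a x => by
    rw [conjMap_apply, conjMap_apply, star_star, mul_assoc, tr_mul_comm]
    simp only [mul_assoc]).symm

variable {ι : Type*} [Fintype ι] (b : OrthonormalBasis ι ℂ H)

theorem superTrace_hsAdjoint (φ : OpMap H) : superTrace b (hsAdjoint φ) = superTrace b φ := by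
  rw [superTrace_eq_sum_tr, superTrace_eq_sum_tr, Finset.sum_comm]
  refine Finset.sum_congr rfl fun i _ => Finset.sum_congr rfl fun j _ => ?_
  rw [tr_mul_comm, ← tr_hsAdjoint]

theorem transposeMap_transposeMap (a : Op H) : transposeMap b (transposeMap b a) = a :=
  op_ext b fun i j => by rw [inner_transposeMap, inner_transposeMap]

theorem transposeMap_matrixUnit (i j : ι) :
    transposeMap b (matrixUnit b i j) = matrixUnit b j i := by
  classical
  refine op_ext b fun k l => ?_
  rw [inner_transposeMap, inner_matrixUnit, inner_matrixUnit]
  simp only [and_comm, eq_comm]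

theorem hsAdjoint_transposeMap : hsAdjoint (transposeMap b) = transposeMap b := by
  refine (eq_hsAdjoint _ _ fun a x => ?_).symm
  rw [eq_sum_matrixUnit b x]
  simp only [map_sum, map_smul, Finset.mul_sum, mul_smul_comm, tr_sum, tr_smul,
    transposeMap_matrixUnit, tr_mul_matrixUnit, inner_transposeMap]

theorem hsAdjoint_transposeConj (φ : OpMap H) :
    hsAdjoint (transposeConj b φ) = transposeConj b (hsAdjoint φ) := by
  simp only [transposeConj, hsAdjoint_comp, hsAdjoint_transposeMap,
    ContinuousLinearMap.comp_assoc]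

theorem transposeConj_transposeConj (φ : OpMap H) : transposeConj b (transposeConj b φ) = φ := by
  ext1 a
  simp [transposeConj, transposeMap_transposeMap]

end HSAdjoint

/-! ### Self-duality of the cone of positive operators -/

section PositiveMaps

variable {H : Type*} [NormedAddCommGroup H] [InnerProductSpace ℂ H] [FiniteDimensional ℂ H]

theorem tr_mul_rankOne (a : Op H) (x : H) :
    tr (a * InnerProductSpace.rankOne ℂ x x) = ⟪x, a x⟫_ℂ := by
  have : a * InnerProductSpace.rankOne ℂ x x = InnerProductSpace.rankOne ℂ (a x) x := by
    ext y; simp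
  rw [this, tr]
  exact InnerProductSpace.trace_rankOne ..

theorem nonneg_iff_exists_sum_rankOne (a : Op H) :
    0 ≤ a ↔ ∃ (m : ℕ) (u : Fin m → H), a = ∑ k, InnerProductSpace.rankOne ℂ (u k) (u k) := by
  rw [ContinuousLinearMap.nonneg_iff_isPositive, ContinuousLinearMap.isPositive_iff_eq_sum_rankOne]

theorem tr_mul_nonneg {a a' : Op H} (ha : 0 ≤ a) (ha' : 0 ≤ a') : 0 ≤ tr (a * a') := by
  obtain ⟨m, u, rfl⟩ := (nonneg_iff_exists_sum_rankOne a').1 ha'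
  simp only [Finset.mul_sum, tr_sum, tr_mul_rankOne]
  exact Finset.sum_nonneg fun k _ => (nonneg_iff_forall_inner a).1 ha _

/-- The cone of positive operators is self-dual for the trace pairing. -/
theorem nonneg_iff_forall_tr_mul (a : Op H) : 0 ≤ a ↔ ∀ a', 0 ≤ a' → 0 ≤ tr (a * a') := by
  refine ⟨fun ha a' ha' => tr_mul_nonneg ha ha', fun h => ?_⟩
  refine (nonneg_iff_forall_inner a).2 fun x => ?_
  rw [← tr_mul_rankOne]
  exact h _ ((ContinuousLinearMap.nonneg_iff_isPositive _).2
    (InnerProductSpace.isPositive_rankOne_self x))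

theorem IsPositiveMap.hsAdjoint {φ : OpMap H} (h : IsPositiveMap φ) :
    IsPositiveMap (hsAdjoint φ) := by
  intro a ha
  rw [nonneg_iff_forall_tr_mul]
  intro a' ha'
  rw [tr_mul_comm, ← tr_hsAdjoint]
  exact tr_mul_nonneg (h _ ha') ha

variable {ι : Type*} [Fintype ι] (b : OrthonormalBasis ι ℂ H)

theorem isPositiveMap_transposeMap : IsPositiveMap (transposeMap b) := by
  intro a ha
  obtain ⟨m, u, rfl⟩ := (nonneg_iff_exists_sum_rankOne a).1 ha
  -- `t |x⟩⟨x| = |x̄⟩⟨x̄|`, with `x̄` the coordinatewise complex conjugate of `x`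
  have key : ∀ x : H, transposeMap b (InnerProductSpace.rankOne ℂ x x)
      = InnerProductSpace.rankOne ℂ (∑ i, ⟪x, b i⟫_ℂ • b i) (∑ i, ⟪x, b i⟫_ℂ • b i) := by
    classical
    intro x
    refine op_ext b fun i j => ?_
    simp [inner_transposeMap, InnerProductSpace.rankOne_apply, -map_sum,
      sum_inner, inner_smul_left, OrthonormalBasis.inner_eq_ite, mul_comm]
  rw [map_sum]
  exact (nonneg_iff_exists_sum_rankOne _).2 ⟨m, _, Finset.sum_congr rfl fun k _ => key (u k)⟩

theorem IsPositiveMap.transposeConj {φ : OpMap H} (h : IsPositiveMap φ) :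
    IsPositiveMap (transposeConj b φ) :=
  ((isPositiveMap_transposeMap b).comp h).comp (isPositiveMap_transposeMap b)

end PositiveMaps

/-! ### Choi matrices -/

section Choi

variable {H : Type*} [NormedAddCommGroup H] [InnerProductSpace ℂ H]

theorem exists_eq_sum_tmul {ι : Type*} [Fintype ι] (b : OrthonormalBasis ι ℂ H) (z : H ⊗[ℂ] H) :
    ∃ x : ι → H, z = ∑ i, b i ⊗ₜ[ℂ] x i := by
  induction z with
  | zero => exact ⟨0, by simp⟩
  | add z z' hz hz' =>
    obtain ⟨x, rfl⟩ := hz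
    obtain ⟨x', rfl⟩ := hz'
    exact ⟨x + x', by simp [TensorProduct.tmul_add, Finset.sum_add_distrib]⟩
  | tmul x y =>
    refine ⟨fun i => ⟪b i, x⟫_ℂ • y, ?_⟩
    conv_lhs => rw [← b.sum_repr' x]
    simp [TensorProduct.sum_tmul, TensorProduct.smul_tmul]

variable [FiniteDimensional ℂ H]

theorem tensorOp_tmul (a a' : Op H) (x y : H) : tensorOp a a' (x ⊗ₜ y) = a x ⊗ₜ[ℂ] a' y := rfl

theorem tensorOp_mul (a a' c c' : Op H) :
    tensorOp a a' * tensorOp c c' = tensorOp (a * c) (a' * c') := by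
  refine ContinuousLinearMap.coe_injective (TensorProduct.ext' fun x y => ?_)
  rfl

theorem tr_tensorOp (a a' : Op H) : tr (tensorOp a a') = tr a * tr a' :=
  LinearMap.trace_tensorProduct' (a : H →ₗ[ℂ] H) (a' : H →ₗ[ℂ] H)

theorem inner_tensorOp_right [CompleteSpace H] (v : Op H) (z w : H ⊗[ℂ] H) :
    ⟪z, tensorOp 1 v w⟫_ℂ = ⟪tensorOp 1 (star v) z, w⟫_ℂ := by
  induction z with
  | zero => simp
  | add z z' hz hz' => simp only [inner_add_left, map_add, hz, hz']
  | tmul x y =>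
    induction w with
    | zero => simp
    | add w w' hw hw' => simp only [inner_add_right, map_add, hw, hw']
    | tmul x' y' =>
      simp [tensorOp_tmul, ContinuousLinearMap.star_eq_adjoint,
        ContinuousLinearMap.adjoint_inner_left]

/-- The elementary tensors `a ⊗ a'` span `B(H ⊗ H)`. -/
theorem opMap_tensor_ext {Φ Ψ : OpMap (H ⊗[ℂ] H)}
    (h : ∀ a a' : Op H, Φ (tensorOp a a') = Ψ (tensorOp a a')) : Φ = Ψ := by
  refine ContinuousLinearMap.ext fun y => ?_
  obtain ⟨z, hz⟩ := (homTensorHomEquiv ℂ H H H H).surjective (y : H ⊗[ℂ] H →ₗ[ℂ] H ⊗[ℂ] H)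
  have hy : y = LinearMap.toContinuousLinearMap (homTensorHomEquiv ℂ H H H H z) := by
    rw [hz]; ext; rfl
  rw [hy]
  clear hz hy
  induction z with
  | zero => simp
  | add z z' hz hz' => simp only [map_add, hz, hz']
  | tmul f g =>
    have := h (LinearMap.toContinuousLinearMap f) (LinearMap.toContinuousLinearMap g)
    simpa [homTensorHomEquiv_apply, tensorOp] using this

theorem idTensor_comp (φ ψ : OpMap H) :
    idTensor (φ.comp ψ) = (idTensor φ).comp (idTensor ψ) :=
  opMap_tensor_ext fun a a' => by
    simp [idTensor_tensorOp]

theorem tensorOp_add_right (a a' a'' : Op H) :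
    tensorOp a (a' + a'') = tensorOp a a' + tensorOp a a'' := by
  simp [tensorOp, TensorProduct.map_add_right]

theorem tensorOp_sum_right {κ : Type*} (s : Finset κ) (a : Op H) (f : κ → Op H) :
    tensorOp a (∑ k ∈ s, f k) = ∑ k ∈ s, tensorOp a (f k) :=
  map_sum (AddMonoidHom.mk' (tensorOp a) (tensorOp_add_right a)) f s

theorem idTensor_sum_conjMap [CompleteSpace H] {κ : Type*} [Fintype κ] (v : κ → Op H)
    (y : Op (H ⊗[ℂ] H)) :
    idTensor (∑ k, conjMap (v k)) y
      = ∑ k, tensorOp 1 (v k) * (y * tensorOp 1 (star (v k))) := by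
  have h : idTensor (∑ k, conjMap (v k))
      = ∑ k, (ContinuousLinearMap.mul ℂ (Op (H ⊗[ℂ] H)) (tensorOp 1 (v k))).comp
          ((ContinuousLinearMap.mul ℂ (Op (H ⊗[ℂ] H))).flip (tensorOp 1 (star (v k)))) :=
    opMap_tensor_ext fun a a' => by
      simp [idTensor_tensorOp, tensorOp_sum_right, conjMap_apply, tensorOp_mul]
  rw [h]
  simp

theorem idTensor_sum_conjMap_nonneg [CompleteSpace H] {κ : Type*} [Fintype κ] (v : κ → Op H)
    {y : Op (H ⊗[ℂ] H)} (hy : 0 ≤ y) : 0 ≤ idTensor (∑ k, conjMap (v k)) y := by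
  rw [idTensor_sum_conjMap, nonneg_iff_forall_inner]
  intro z
  simp only [sum_apply, inner_sum, mul_apply_eq_comp, inner_tensorOp_right]
  exact Finset.sum_nonneg fun k _ => (nonneg_iff_forall_inner y).1 hy _

variable {ι : Type*} [Fintype ι] (b : OrthonormalBasis ι ℂ H)

/-- The trace pairing of Choi matrices is the Hilbert-Schmidt pairing of maps. -/
theorem tr_choi_mul_choi (φ α : OpMap H) :
    tr (choi b φ * choi b α) = superTrace b ((hsAdjoint φ).comp α) := by
  classical
  have h : ∀ i j k l, tr (tensorOp (matrixUnit b i j) (φ (matrixUnit b i j)) *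
      tensorOp (matrixUnit b k l) (α (matrixUnit b k l)))
      = if k = j ∧ i = l then
        tr (φ (matrixUnit b i j) * α (matrixUnit b k l)) else 0 := by
    intro i j k l
    rw [tensorOp_mul, tr_tensorOp, tr_mul_comm, tr_mul_matrixUnit, inner_matrixUnit]
    simp only [ite_mul, one_mul, zero_mul, and_comm, eq_comm]
  simp only [choi, Finset.sum_mul, Finset.mul_sum, tr_sum, h, superTrace_eq_sum_tr,
    ContinuousLinearMap.comp_apply, ite_and, Finset.sum_ite_eq, Finset.sum_ite_eq',
    Finset.mem_univ, if_true]
  refine Finset.sum_congr rfl fun i _ => Finset.sum_congr rfl fun j _ => ?_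
  rw [tr_mul_comm (hsAdjoint φ _), ← tr_hsAdjoint]

theorem choi_eq_idTensor (φ : OpMap H) :
    choi b φ = idTensor φ (choi b (ContinuousLinearMap.id ℂ (Op H))) := by
  simp [choi, map_sum, idTensor_tensorOp]

theorem choi_apply_tmul (φ : OpMap H) (j : ι) (y : H) :
    choi b φ (b j ⊗ₜ y) = ∑ i, b i ⊗ₜ φ (matrixUnit b i j) y := by
  classical
  simp [choi, tensorOp_tmul, matrixUnit_apply, OrthonormalBasis.inner_eq_ite, ite_smul,
    TensorProduct.ite_tmul]

theorem inner_choi_sum (φ : OpMap H) (x y : ι → H) :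
    ⟪∑ i, b i ⊗ₜ[ℂ] x i, choi b φ (∑ j, b j ⊗ₜ[ℂ] y j)⟫_ℂ
      = ∑ i, ∑ j, ⟪x i, φ (matrixUnit b i j) (y j)⟫_ℂ := by
  classical
  simp only [map_sum, choi_apply_tmul, inner_sum, sum_inner, TensorProduct.inner_tmul,
    OrthonormalBasis.inner_eq_ite, ite_mul, one_mul, zero_mul, Finset.sum_ite_eq',
    Finset.mem_univ, if_true]
  exact Finset.sum_comm

theorem choi_nonneg_iff (φ : OpMap H) :
    0 ≤ choi b φ ↔ ∀ x : ι → H, 0 ≤ ∑ i, ∑ j, ⟪x i, φ (matrixUnit b i j) (x j)⟫_ℂ := by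
  rw [nonneg_iff_forall_inner]
  refine ⟨fun h x => by simpa only [inner_choi_sum] using h (∑ i, b i ⊗ₜ[ℂ] x i), fun h z => ?_⟩
  obtain ⟨x, rfl⟩ := exists_eq_sum_tmul b z
  rw [inner_choi_sum]
  exact h x

/-- Positivity of a Choi matrix is tested by traces: a vector of `H ⊗ H` is `∑ b i ⊗ v† (b i)` for
some operator `v`, so the quadratic form of `C_φ` takes the values `Tr (Ad_v ∘ φ)`. -/
theorem choi_nonneg_of_superTrace [CompleteSpace H] {φ : OpMap H}
    (h : ∀ v : Op H, 0 ≤ superTrace b ((conjMap v).comp φ)) : 0 ≤ choi b φ := by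
  classical
  refine (choi_nonneg_iff b φ).2 fun x => ?_
  let w : Op H := ∑ i, InnerProductSpace.rankOne ℂ (x i) (b i)
  have hw : ∀ i, w (b i) = x i := by
    intro i
    simp [w, OrthonormalBasis.inner_eq_ite]
  have := h (star w)
  simpa only [superTrace, ContinuousLinearMap.comp_apply, inner_conjMap, star_star, hw] using this

theorem choi_id_nonneg : 0 ≤ choi b (ContinuousLinearMap.id ℂ (Op H)) := by
  refine (choi_nonneg_iff b _).2 fun x => ?_
  have : ∑ i, ∑ j, ⟪x i, ContinuousLinearMap.id ℂ (Op H) (matrixUnit b i j) (x j)⟫_ℂ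
      = star (∑ i, ⟪b i, x i⟫_ℂ) * ∑ i, ⟪b i, x i⟫_ℂ := by
    simp [matrixUnit_apply, Finset.sum_mul_sum, mul_comm]
  rw [this]
  exact star_mul_self_nonneg _

/-- A map with positive Choi matrix has a Kraus decomposition. A spectral decomposition
`∑ |u_k⟩⟨u_k|` of the Choi matrix yields the operators `v_k`, by reading the vector
`u_k ∈ H ⊗ H` as an operator. -/
theorem exists_eq_sum_conjMap [CompleteSpace H] {φ : OpMap H} (h : 0 ≤ choi b φ) :
    ∃ (m : ℕ) (v : Fin m → Op H), φ = ∑ k, conjMap (v k) := by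
  classical
  obtain ⟨m, u, hu⟩ := (nonneg_iff_exists_sum_rankOne _).1 h
  choose x hx using fun k => exists_eq_sum_tmul b (u k)
  -- `u k = ∑ b i ⊗ v k (b i)`
  let v : Fin m → Op H := fun k => ∑ i, InnerProductSpace.rankOne ℂ (x k i) (b i)
  refine ⟨m, v, opMap_ext b fun i j => op_ext b fun p q => ?_⟩
  have hv : ∀ k i, v k (b i) = x k i := by
    intro k i
    simp [v, OrthonormalBasis.inner_eq_ite]
  have hl : ⟪b i ⊗ₜ[ℂ] b p, choi b φ (b j ⊗ₜ[ℂ] b q)⟫_ℂ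
      = ⟪b p, φ (matrixUnit b i j) (b q)⟫_ℂ := by
    simp [choi_apply_tmul, inner_sum, OrthonormalBasis.inner_eq_ite]
  have hr : ∀ k, ⟪b i ⊗ₜ[ℂ] b p, InnerProductSpace.rankOne ℂ (u k) (u k) (b j ⊗ₜ[ℂ] b q)⟫_ℂ
      = ⟪b p, conjMap (v k) (matrixUnit b i j) (b q)⟫_ℂ := by
    intro k
    rw [inner_conjMap, matrixUnit_apply, ContinuousLinearMap.star_eq_adjoint, inner_smul_right,
      ContinuousLinearMap.adjoint_inner_left, ContinuousLinearMap.adjoint_inner_right, hv, hv,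
      InnerProductSpace.rankOne_apply, inner_smul_right, hx]
    simp [inner_sum, sum_inner, OrthonormalBasis.inner_eq_ite]
  rw [← hl, hu]
  simp only [sum_apply, inner_sum, hr]

end Choi

/-! ### Complete positivity -/

section CompletelyPositive

variable {H : Type*} [NormedAddCommGroup H] [InnerProductSpace ℂ H] [CompleteSpace H]

theorem isCP_sum_conjMap {κ : Type*} [Fintype κ] (v : κ → Op H) :
    IsCP (∑ k, conjMap (v k)) := by
  refine ⟨⟨((∑ k, conjMap (v k) : OpMap H) : Op H →ₗ[ℂ] Op H), fun n M hM => ?_⟩, fun a => rfl⟩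
  have hMap : M.map ((∑ k, conjMap (v k) : OpMap H) : Op H →ₗ[ℂ] Op H)
      = ∑ k, (CStarMatrix.ofMatrix (Matrix.diagonal fun _ : Fin n => v k)) * M *
          star (CStarMatrix.ofMatrix (Matrix.diagonal fun _ : Fin n => v k)) := by
    have hD : ∀ k (i j : Fin n), CStarMatrix.ofMatrix (Matrix.diagonal fun _ : Fin n => v k) i j
        = if i = j then v k else 0 := fun k i j => Matrix.diagonal_apply ..
    have hsum : ∀ (f : κ → CStarMatrix (Fin n) (Fin n) (Op H)) i j,
        (∑ k, f k) i j = ∑ k, f k i j := fun f i j => Matrix.sum_apply i j _ f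
    ext1 i j
    rw [hsum]
    simp [CStarMatrix.mul_apply, CStarMatrix.star_apply, hD, conjMap_apply, mul_assoc,
      apply_ite star, mul_ite, ite_mul]
  rw [hMap]
  exact Finset.sum_nonneg fun k _ => star_right_conjugate_nonneg hM _

theorem isCP_conjMap (v : Op H) : IsCP (conjMap v) := by
  simpa using isCP_sum_conjMap fun _ : Unit => v

/-- A positive operator matrix has a nonnegative quadratic form. -/
theorem sum_inner_nonneg_of_cstarMatrix_nonneg {ι : Type*} [Fintype ι]
    {M : CStarMatrix ι ι (Op H)} (hM : 0 ≤ M) (x : ι → H) :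
    0 ≤ ∑ i, ∑ j, ⟪x i, M i j (x j)⟫_ℂ := by
  rw [StarOrderedRing.nonneg_iff] at hM
  induction hM using AddSubmonoid.closure_induction with
  | zero => simp
  | add M N _ _ hM hN =>
    simpa [inner_add_right, Finset.sum_add_distrib] using add_nonneg hM hN
  | mem M hM =>
    obtain ⟨N, rfl⟩ := hM
    have hsum : ∑ i, ∑ j, ⟪x i, (star N * N) i j (x j)⟫_ℂ
        = ∑ k, ⟪∑ i, N k i (x i), ∑ j, N k j (x j)⟫_ℂ := by
      simp only [CStarMatrix.mul_apply, CStarMatrix.star_apply, sum_apply, mul_apply_eq_comp,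
        inner_sum, sum_inner, ContinuousLinearMap.star_eq_adjoint,
        ContinuousLinearMap.adjoint_inner_right]
      rw [Finset.sum_comm, Finset.sum_congr rfl fun _ _ => Finset.sum_comm, Finset.sum_comm]
    rw [hsum]
    exact Finset.sum_nonneg fun k _ => by
      rw [inner_self_eq_norm_sq_to_K]
      positivity

variable [FiniteDimensional ℂ H] {ι : Type*} [Fintype ι] (b : OrthonormalBasis ι ℂ H)

theorem IsCP.choi_nonneg {φ : OpMap H} (h : IsCP φ) : 0 ≤ choi b φ := by
  classical
  obtain ⟨Φ, hΦ⟩ := h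
  let E : CStarMatrix ι ι (Op H) := CStarMatrix.ofMatrix (Matrix.of fun i j => matrixUnit b i j)
  have hE_apply : ∀ i j, E i j = matrixUnit b i j := fun i j => rfl
  -- The matrix of matrix units is self-adjoint with `E * E = (dim H) • E`.
  have hE : E = (Fintype.card ι : ℝ)⁻¹ • (star E * E) := by
    ext1 i j
    have : Nonempty ι := ⟨i⟩
    have hstar : ∀ k, star (matrixUnit b k i) = matrixUnit b i k := fun k => by
      rw [ContinuousLinearMap.star_eq_adjoint, matrixUnit, matrixUnit,
        InnerProductSpace.adjoint_rankOne]
    have hsum : (star E * E) i j = Fintype.card ι • matrixUnit b i j := by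
      simp [CStarMatrix.mul_apply, CStarMatrix.star_apply, hE_apply, hstar, matrixUnit_mul]
    rw [CStarMatrix.smul_apply, hsum, hE_apply, ← Nat.cast_smul_eq_nsmul ℝ, smul_smul,
      inv_mul_cancel₀ (Nat.cast_ne_zero.2 Fintype.card_ne_zero), one_smul]
  have hE0 : 0 ≤ E := by
    rw [hE]
    exact smul_nonneg (by positivity) (star_mul_self_nonneg E)
  have hΦE := sum_inner_nonneg_of_cstarMatrix_nonneg (Φ.map_cstarMatrix_nonneg E hE0)
  refine (choi_nonneg_iff b φ).2 fun x => ?_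
  simpa only [CStarMatrix.map_apply, hE_apply, hΦ] using hΦE x

/-- Choi's criterion for complete positivity. -/
theorem isCP_iff_choi_nonneg (φ : OpMap H) : IsCP φ ↔ 0 ≤ choi b φ := by
  refine ⟨fun h => h.choi_nonneg b, fun h => ?_⟩
  obtain ⟨m, v, rfl⟩ := exists_eq_sum_conjMap b h
  exact isCP_sum_conjMap v

/-- Completely positive maps are those with a Kraus decomposition. -/
theorem isCP_iff_exists_sum_conjMap (φ : OpMap H) :
    IsCP φ ↔ ∃ (m : ℕ) (v : Fin m → Op H), φ = ∑ k, conjMap (v k) := by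
  refine ⟨fun h => exists_eq_sum_conjMap _ (h.choi_nonneg (stdOrthonormalBasis ℂ H)), ?_⟩
  rintro ⟨m, v, rfl⟩
  exact isCP_sum_conjMap v

theorem IsCP.isPositiveMap {φ : OpMap H} (h : IsCP φ) : IsPositiveMap φ := by
  obtain ⟨m, v, rfl⟩ := (isCP_iff_exists_sum_conjMap φ).1 h
  intro a ha
  rw [nonneg_iff_forall_inner]
  intro x
  simp only [sum_apply, inner_sum, inner_conjMap]
  exact Finset.sum_nonneg fun k _ => (nonneg_iff_forall_inner a).1 ha _

theorem IsCP.hsAdjoint {φ : OpMap H} (h : IsCP φ) : IsCP (hsAdjoint φ) := by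
  obtain ⟨m, v, rfl⟩ := (isCP_iff_exists_sum_conjMap φ).1 h
  simp only [hsAdjoint_sum, hsAdjoint_conjMap]
  exact isCP_sum_conjMap _

/-- In finite dimension, complete positivity is positivity of `ι ⊗ φ` on `B(H ⊗ H)`. -/
theorem isCP_iff_idTensor_nonneg (φ : OpMap H) :
    IsCP φ ↔ ∀ y : Op (H ⊗[ℂ] H), 0 ≤ y → 0 ≤ idTensor φ y := by
  refine ⟨fun h y hy => ?_, fun h => ?_⟩
  · obtain ⟨m, v, rfl⟩ := (isCP_iff_exists_sum_conjMap φ).1 h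
    exact idTensor_sum_conjMap_nonneg v hy
  · rw [isCP_iff_choi_nonneg (stdOrthonormalBasis ℂ H), choi_eq_idTensor]
    exact h _ (choi_id_nonneg _)

theorem IsCP.comp {φ ψ : OpMap H} (hφ : IsCP φ) (hψ : IsCP ψ) : IsCP (φ.comp ψ) := by
  rw [isCP_iff_idTensor_nonneg] at *
  intro y hy
  rw [idTensor_comp]
  rw [ContinuousLinearMap.comp_apply]
  exact hφ (idTensor ψ y) (hψ y hy)

end CompletelyPositive

/-! ### Duality of mapping cones -/

section DualCones

variable {H : Type*} [NormedAddCommGroup H] [InnerProductSpace ℂ H]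

theorem isClosed_nonneg_op : IsClosed {a : Op H | 0 ≤ a} := by
  simp only [nonneg_iff_forall_inner, Set.ofPred_forall]
  refine isClosed_iInter fun x => isClosed_Ici.preimage (f := fun a : Op H => ⟪x, a x⟫_ℂ) ?_
  fun_prop

theorem isClosed_isPositiveMap : IsClosed {φ : OpMap H | IsPositiveMap φ} := by
  simp only [IsPositiveMap, Set.ofPred_forall]
  refine isClosed_iInter fun a => isClosed_iInter fun _ =>
    isClosed_nonneg_op.preimage (f := fun φ : OpMap H => φ a) ?_
  fun_prop

variable [CompleteSpace H] [FiniteDimensional ℂ H] {ι : Type*} [Fintype ι]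
  (b : OrthonormalBasis ι ℂ H)
  {K : Set (OpMap H)}

/-- Since `(ι ⊗ β) ∘ (ι ⊗ α^*) = ι ⊗ (β ∘ α^*)`, it is enough to test `β` on the generators of the
cone `C^K`. -/
theorem mem_sharp_iff (β : OpMap H) : β ∈ sharp K ↔
    IsPositiveMap β ∧ ∀ α ∈ K, IsCP (β.comp (hsAdjoint α)) := by
  simp only [sharp, Set.mem_ofPred_eq, and_congr_right_iff, isCP_iff_idTensor_nonneg, idTensor_comp]
  intro _
  refine ⟨fun h α hα y hy => by
    rw [ContinuousLinearMap.comp_apply]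
    exact h _ (subset_closure (Submodule.subset_span ⟨α, hα, y, hy, rfl⟩)), fun h x hx => ?_⟩
  have hclosed : IsClosed {x | 0 ≤ idTensor β x} :=
    isClosed_nonneg_op.preimage (idTensor β).continuous
  refine closure_minimal (fun x hx => ?_) hclosed hx
  induction hx using Submodule.span_induction with
  | mem x hx =>
    obtain ⟨α, hα, y, hy, rfl⟩ := hx
    exact h α hα y hy
  | zero => simp
  | add x y _ _ hx hy =>
    rw [Set.mem_ofPred_eq, map_add]
    exact add_nonneg hx hy
  | smul c x _ hx =>
    have hx' : 0 ≤ idTensor β x := hx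
    have : idTensor β (c • x) = (c : ℝ) • idTensor β x :=
      ((idTensor β).restrictScalars ℝ).map_smul (c : ℝ) x
    rw [Set.mem_ofPred_eq, this]
    exact real_smul_nonneg c.2 hx'

/-- Complete positivity of all `β ∘ α^*` reduces to one scalar inequality for each `α`, because `K`
absorbs the conjugations `Ad_v` that appear when the Choi matrix of `β ∘ α^*` is tested on
vectors. -/
theorem mem_sharp_iff_superTrace (hK : IsMappingCone K) (β : OpMap H) : β ∈ sharp K ↔
    IsPositiveMap β ∧ ∀ α ∈ K, 0 ≤ superTrace b (β.comp (hsAdjoint α)) := by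
  rw [mem_sharp_iff, and_congr_right_iff]
  refine fun _ => ⟨fun h α hα => ?_, fun h α hα => ?_⟩
  -- The quadratic form of the Choi matrix at `∑ b i ⊗ b i` is the trace of the map.
  · exact (choi_nonneg_iff b _).1 ((h α hα).choi_nonneg b) b
  · rw [isCP_iff_choi_nonneg b]
    refine choi_nonneg_of_superTrace b fun v => ?_
    have := h _ (hK.comp_left _ (isCP_conjMap (star v)) α hα)
    rwa [hsAdjoint_comp, hsAdjoint_conjMap, star_star, ← ContinuousLinearMap.comp_assoc,
      superTrace_comp_comm] at this

theorem sharp_eq_dualCone (hK : IsMappingCone K) : sharp K = dualCone b K := by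
  ext β
  have hpair : ∀ α, superTrace b ((hsAdjoint β).comp α) = superTrace b (β.comp (hsAdjoint α)) := by
    intro α
    rw [← superTrace_hsAdjoint, hsAdjoint_comp, hsAdjoint_hsAdjoint, superTrace_comp_comm]
  simp only [mem_sharp_iff_superTrace b hK, dualCone, Set.mem_ofPred_eq, tr_choi_mul_choi, hpair]

theorem isClosed_sharp (hK : IsMappingCone K) : IsClosed (sharp K) := by
  have h : sharp K = {β | IsPositiveMap β} ∩
      ⋂ α ∈ K, {β | 0 ≤ superTrace (stdOrthonormalBasis ℂ H) (β.comp (hsAdjoint α))} := by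
    ext β
    simp [mem_sharp_iff_superTrace (stdOrthonormalBasis ℂ H) hK]
  rw [h]
  refine isClosed_isPositiveMap.inter (isClosed_biInter fun α _ =>
    isClosed_Ici.preimage (f := fun β : OpMap H =>
      superTrace (stdOrthonormalBasis ℂ H) (β.comp (hsAdjoint α))) ?_)
  simp only [superTrace, ContinuousLinearMap.comp_apply]
  fun_prop

theorem isSymmetricMappingCone_sharp (hK : IsSymmetricMappingCone b K) :
    IsSymmetricMappingCone b (sharp K) := by
  have hmem := mem_sharp_iff_superTrace b hK.toIsMappingCone
  have hadj : ∀ β ∈ sharp K, hsAdjoint β ∈ sharp K := by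
    intro β hβ
    rw [hmem] at hβ ⊢
    refine ⟨hβ.1.hsAdjoint, fun α hα => ?_⟩
    have h := hβ.2 _ ((hK.hsAdjoint_mem_iff α).1 hα)
    rwa [hsAdjoint_hsAdjoint, superTrace_comp_comm, ← superTrace_hsAdjoint, hsAdjoint_comp] at h
  have htr : ∀ β ∈ sharp K, transposeConj b β ∈ sharp K := by
    intro β hβ
    rw [hmem] at hβ ⊢
    refine ⟨hβ.1.transposeConj b, fun α hα => ?_⟩
    have h := hβ.2 _ ((hK.transposeConj_mem_iff α).1 hα)
    rw [hsAdjoint_transposeConj, transposeConj, ← ContinuousLinearMap.comp_assoc,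
      superTrace_comp_comm] at h
    exact h
  exact
    { isPositiveMap := fun β hβ => hβ.1
      zero_mem := (hmem 0).2 ⟨fun a _ => by simp, fun α _ => by simp [superTrace]⟩
      add_mem := fun φ hφ ψ hψ => by
        rw [hmem] at *
        refine ⟨fun a ha => add_nonneg (hφ.1 a ha) (hψ.1 a ha), fun α hα => ?_⟩
        have := add_nonneg (hφ.2 α hα) (hψ.2 α hα)
        simpa [superTrace, inner_add_right, Finset.sum_add_distrib] using this
      smul_mem := fun c hc φ hφ => by
        rw [hmem] at *
        refine ⟨fun a ha => real_smul_nonneg hc (hφ.1 a ha), fun α hα => ?_⟩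
        have := smul_nonneg hc (hφ.2 α hα)
        simpa [superTrace, Finset.mul_sum, inner_smul_right_eq_smul, Finset.smul_sum] using this
      isClosed := isClosed_sharp hK.toIsMappingCone
      comp_left := fun γ hγ β hβ => by
        rw [mem_sharp_iff] at hβ ⊢
        refine ⟨hγ.isPositiveMap.comp hβ.1, fun α hα => ?_⟩
        rw [ContinuousLinearMap.comp_assoc]
        exact hγ.comp (hβ.2 α hα)
      comp_right := fun γ hγ β hβ => by
        rw [mem_sharp_iff] at hβ ⊢
        refine ⟨hβ.1.comp hγ.isPositiveMap, fun α hα => ?_⟩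
        have := hβ.2 _ (hK.comp_right _ hγ.hsAdjoint α hα)
        rwa [hsAdjoint_comp, hsAdjoint_hsAdjoint, ← ContinuousLinearMap.comp_assoc] at this
      hsAdjoint_mem_iff := fun β =>
        ⟨hadj β, fun h => hsAdjoint_hsAdjoint β ▸ hadj _ h⟩
      transposeConj_mem_iff := fun β =>
        ⟨htr β, fun h => transposeConj_transposeConj b β ▸ htr _ h⟩ }

end DualCones

end MappingCones

end

theorem corollary9 {H : Type*} [NormedAddCommGroup H] [InnerProductSpace ℂ H] [CompleteSpace H]
    [FiniteDimensional ℂ H] {ι : Type*} [Fintype ι] (b : OrthonormalBasis ι ℂ H)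
    (K : Set (MappingCones.OpMap H)) (hK : MappingCones.IsSymmetricMappingCone b K) :
    MappingCones.sharp K = MappingCones.dualCone b K ∧
      MappingCones.sharp K =
        {β | MappingCones.IsPositiveMap β ∧
          ∀ α ∈ K, MappingCones.IsCP (β.comp (MappingCones.hsAdjoint α))} ∧
      MappingCones.IsSymmetricMappingCone b (MappingCones.sharp K) := by
  refine ⟨MappingCones.sharp_eq_dualCone b hK.toIsMappingCone, ?_,
    MappingCones.isSymmetricMappingCone_sharp b hK⟩
  ext β
  exact MappingCones.mem_sharp_iff β
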